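/- Call two finite weighted directed graphs \emph{similar}, written $G\sim H$, if their adjacency matrices are similar matrices over $\mathbb C$ (the $(u,v)$-entry of the adjacency matrix is the weight of the edge from $u$ to $v$ if there is one, and $0$ otherwise; an undirected edge is a pair of anti-parallel directed edges of the same weight, unweighted edges have weight $1$, and a loop of weight $c$ contributes a diagonal entry $c$). For $m\ge 0$, let the \emph{mixed Aztec diamond} $MD_m$ be the graph whose vertices are the black unit squares of a $2m\times 2m$ chessboard, two of them being adjacent if they share a corner, and let $HMD_m$ be the subgraph of $MD_m$ induced by the black squares on or above the black diagonal of the board. For $n\ge 1$, let $R_n$ be the path on $n$ vertices, with edges of weight $1$, carrying in addition a loop of weight $2$ at every vertex except the last and a loop of weight $1$ at the last vertex; let $R'_n$ be the same path with loops of weight $-2$ at every vertex except the last and a loop of weight $-1$ at the last vertex. \textbf{Theorem 3.1.} For every $n\ge 1$, $$MD_n\ \sim\ HMD_{n-1}\ \dot\cup\ HMD_{n-1}\ \dot\cup\ R_n\ \dot\cup\ R'_n ,$$ where $\dot\cup$ denotes disjoint union (and $HMD_0$ is the empty graph). -/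

import Mathlib

/-- A weighted directed graph on the vertex set `V`: a set of directed edges (loops allowed), each
carrying a complex weight. Only the values of `weight` on edges matter. -/
structure WeightedDigraph (V : Type) where
  /-- `Edge u v` says that there is a directed edge from `u` to `v`. -/
  Edge : V → V → Prop
  /-- The weight of the directed edge from `u` to `v`. -/
  weight : V → V → ℂ

namespace WeightedDigraph

open Classical in
/-- The adjacency matrix: the `(u, v)` entry is the weight of the edge from `u` to `v` if there is
such an edge, and `0` otherwise. -/
noncomputable def adjMatrix {V : Type} (G : WeightedDigraph V) : Matrix V V ℂ :=
  Matrix.of fun u v => if G.Edge u v then G.weight u v else 0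

/-- An unweighted undirected graph, seen as a weighted directed graph: each edge becomes a pair of
anti-parallel directed edges of weight `1`. -/
def ofSimpleGraph {V : Type} (G : SimpleGraph V) : WeightedDigraph V where
  Edge := G.Adj
  weight _ _ := 1

/-- The disjoint union of two weighted directed graphs. -/
def disjUnion {V W : Type} (G : WeightedDigraph V) (H : WeightedDigraph W) :
    WeightedDigraph (V ⊕ W) where
  Edge
    | .inl u, .inl v => G.Edge u v
    | .inr u, .inr v => H.Edge u v
    | _, _ => False
  weight
    | .inl u, .inl v => G.weight u v
    | .inr u, .inr v => H.weight u v
    | _, _ => 0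

/-- Two finite weighted directed graphs are similar if their adjacency matrices are similar:
after identifying the vertex sets by some bijection (that is, ordering the vertices of each graph),
the matrices are conjugate by an invertible complex matrix. -/
def Similar {V W : Type} [Fintype V] [DecidableEq V] [Fintype W] [DecidableEq W]
    (G : WeightedDigraph V) (H : WeightedDigraph W) : Prop :=
  ∃ e : V ≃ W, ∃ P : (Matrix W W ℂ)ˣ,
    Matrix.reindex e e G.adjMatrix =
      (P : Matrix W W ℂ) * H.adjMatrix * ((P⁻¹ : (Matrix W W ℂ)ˣ) : Matrix W W ℂ)

end WeightedDigraph

/-- The black unit squares of the `2n × 2n` chessboard, as pairs (column, row); the squares of the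
diagonal `column = row` are black. -/
abbrev BlackSquare (n : ℕ) : Type :=
  {p : Fin (2 * n) × Fin (2 * n) // Even ((p.1 : ℕ) + (p.2 : ℕ))}

/-- The mixed Aztec diamond `MD_n`: its vertices are the black unit squares of the `2n × 2n`
chessboard, two of them being adjacent if they share a corner. Two distinct squares of the same
colour share a corner exactly when their columns and their rows both differ by one. -/
def mixedDiamond (n : ℕ) : SimpleGraph (BlackSquare n) where
  Adj p q :=
    ((p.1.1 : ℕ) + 1 = q.1.1 ∨ (q.1.1 : ℕ) + 1 = p.1.1) ∧
      ((p.1.2 : ℕ) + 1 = q.1.2 ∨ (q.1.2 : ℕ) + 1 = p.1.2)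
  symm := ⟨fun _ _ h => ⟨h.1.symm, h.2.symm⟩⟩
  loopless := ⟨fun p h => by rcases h.1 with h | h <;> omega⟩

/-- The black squares on or above the black diagonal of the `2n × 2n` chessboard. -/
abbrev UpperBlackSquare (n : ℕ) : Type :=
  {p : BlackSquare n // p.1.1 ≤ p.1.2}

/-- The halved mixed Aztec diamond `HMD_n`: the subgraph of `MD_n` induced by the black squares on
or above the black diagonal. -/
def halvedMixedDiamond (n : ℕ) : SimpleGraph (UpperBlackSquare n) :=
  (mixedDiamond n).comap Subtype.val

/-- The path on `n` vertices (edges of weight `1`) with a loop of weight `c i` at each vertex `i`.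
A loop of weight `c` contributes `c` to the diagonal of the adjacency matrix. -/
noncomputable def loopedPath (n : ℕ) (c : Fin n → ℂ) : WeightedDigraph (Fin n) where
  Edge i j := (SimpleGraph.pathGraph n).Adj i j ∨ i = j
  weight i j := if i = j then c i else 1

/-- `R_n`: the path on `n` vertices with a loop of weight `2` at each vertex but the last, and a
loop of weight `1` at the last vertex. -/
noncomputable def loopedPathR (n : ℕ) : WeightedDigraph (Fin n) :=
  loopedPath n fun i => if (i : ℕ) + 1 = n then 1 else 2

/-- `R'_n`: the path on `n` vertices with a loop of weight `-2` at each vertex but the last, and a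
loop of weight `-1` at the last vertex. -/
noncomputable def loopedPathR' (n : ℕ) : WeightedDigraph (Fin n) :=
  loopedPath n fun i => if (i : ℕ) + 1 = n then -1 else -2

/-! A diagonal step changes the parity of both coordinates, so `MD_n` is bipartite. With even
coordinates counted backwards, its biadjacency matrix is `A ⊗ A`, where `A` is the symmetric
biadjacency matrix of the path on `2n` vertices; hence `MD_n ~ (A ⊗ A) ⊕ -(A ⊗ A)`.

`A` is diagonalizable, and the eigenvalues `d i * d j` of `A ⊗ A` split by `i < j`, `j < i` and `i =
j`: two copies of the second compound `C` of `A`, and `A²`. Here `A²` is the matrix of `R_n`. In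
each minor of `A` the main-diagonal product vanishes, so `-C` is a 0-1 matrix, and it is the
biadjacency matrix of `HMD_{n-1}`; thus `HMD_{n-1} ~ C ⊕ -C`. Regrouping the summands, with `R'_n ~
-R_n`, gives the theorem. -/

open scoped Kronecker

/-! ### Similarity across index types, and block sums -/

namespace Matrix

variable {l m n o : Type} [Fintype l] [DecidableEq l] [Fintype m] [DecidableEq m]
  [Fintype n] [DecidableEq n] [Fintype o] [DecidableEq o]

/-- Similarity of square matrices with possibly different index types. -/
def Sim (A : Matrix m m ℂ) (B : Matrix n n ℂ) : Prop :=
  ∃ (P : Matrix m n ℂ) (Q : Matrix n m ℂ), P * Q = 1 ∧ Q * P = 1 ∧ A = P * B * Q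

theorem Sim.refl (A : Matrix m m ℂ) : Sim A A := ⟨1, 1, by simp, by simp, by simp⟩

theorem Sim.symm {A : Matrix m m ℂ} {B : Matrix n n ℂ} (h : Sim A B) : Sim B A := by
  obtain ⟨P, Q, hPQ, hQP, rfl⟩ := h
  refine ⟨Q, P, hQP, hPQ, ?_⟩
  calc B = (Q * P) * B * (Q * P) := by rw [hQP, Matrix.one_mul, Matrix.mul_one]
    _ = Q * (P * B * Q) * P := by simp only [Matrix.mul_assoc]

theorem Sim.trans {A : Matrix l l ℂ} {B : Matrix m m ℂ} {D : Matrix n n ℂ}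
    (h : Sim A B) (h' : Sim B D) : Sim A D := by
  obtain ⟨P, Q, hPQ, hQP, rfl⟩ := h
  obtain ⟨R, S, hRS, hSR, rfl⟩ := h'
  refine ⟨P * R, S * Q, ?_, ?_, by simp only [Matrix.mul_assoc]⟩
  · calc P * R * (S * Q) = P * (R * S) * Q := by simp only [Matrix.mul_assoc]
      _ = 1 := by rw [hRS, Matrix.mul_one, hPQ]
  · calc S * Q * (P * R) = S * (Q * P) * R := by simp only [Matrix.mul_assoc]
      _ = 1 := by rw [hQP, Matrix.mul_one, hSR]

theorem Sim.neg {A : Matrix m m ℂ} {B : Matrix n n ℂ} (h : Sim A B) : Sim (-A) (-B) := by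
  obtain ⟨P, Q, hPQ, hQP, rfl⟩ := h
  exact ⟨P, Q, hPQ, hQP, by simp⟩

theorem Sim.pow_two {A : Matrix m m ℂ} {B : Matrix n n ℂ} (h : Sim A B) :
    Sim (A * A) (B * B) := by
  obtain ⟨P, Q, hPQ, hQP, rfl⟩ := h
  refine ⟨P, Q, hPQ, hQP, ?_⟩
  calc P * B * Q * (P * B * Q) = P * B * (Q * P) * (B * Q) := by simp only [Matrix.mul_assoc]
    _ = P * (B * B) * Q := by rw [hQP, Matrix.mul_one]; simp only [Matrix.mul_assoc]

/-- Relabelling the indices gives a similar matrix. -/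
theorem sim_submatrix (e : m ≃ n) (B : Matrix n n ℂ) : Sim (B.submatrix e e) B := by
  refine ⟨(1 : Matrix n n ℂ).submatrix e id, (1 : Matrix n n ℂ).submatrix id e, ?_, ?_, ?_⟩
  · ext i j
    simp [Matrix.mul_apply, Matrix.one_apply]
  · ext i j
    simp only [Matrix.mul_apply, Matrix.submatrix_apply, id, Matrix.one_apply]
    rw [← e.symm.sum_comp]
    simp
  · ext i j
    simp [Matrix.mul_apply, Matrix.one_apply]

/-- Similarity is compatible with block diagonal sums. -/
theorem Sim.fromBlocks {A : Matrix l l ℂ} {A' : Matrix m m ℂ} {B : Matrix n n ℂ}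
    {B' : Matrix o o ℂ} (h : Sim A A') (h' : Sim B B') :
    Sim (Matrix.fromBlocks A 0 0 B) (Matrix.fromBlocks A' 0 0 B') := by
  obtain ⟨P, Q, hPQ, hQP, rfl⟩ := h
  obtain ⟨R, S, hRS, hSR, rfl⟩ := h'
  refine ⟨Matrix.fromBlocks P 0 0 R, Matrix.fromBlocks Q 0 0 S, ?_, ?_, ?_⟩ <;>
    simp [Matrix.fromBlocks_multiply, *]

/-- A matrix with zero diagonal blocks and equal off-diagonal blocks `X` is similar to `X ⊕ -X`. -/
theorem sim_fromBlocks_antidiagonal (X : Matrix m m ℂ) :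
    Sim (Matrix.fromBlocks 0 X X 0) (Matrix.fromBlocks X 0 0 (-X)) := by
  have half (Y : Matrix m m ℂ) : (2⁻¹ : ℂ) • Y + (2⁻¹ : ℂ) • Y = Y := by
    rw [← add_smul]; norm_num
  -- The columns of the conjugator span the symmetric vectors `(v, v)` and the antisymmetric vectors
  -- `(v, -v)`.
  refine ⟨Matrix.fromBlocks 1 1 1 (-1),
    (2⁻¹ : ℂ) • Matrix.fromBlocks 1 1 1 (-1), ?_, ?_, ?_⟩
  · simp only [Matrix.mul_smul, Matrix.fromBlocks_multiply, Matrix.fromBlocks_smul,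
      ← Matrix.fromBlocks_one]
    congr 1 <;> simp [half]
  · simp only [Matrix.smul_mul, Matrix.fromBlocks_multiply, Matrix.fromBlocks_smul,
      ← Matrix.fromBlocks_one]
    congr 1 <;> simp [half]
  · simp only [Matrix.mul_smul, Matrix.fromBlocks_multiply, Matrix.fromBlocks_smul]
    congr 1 <;> simp [half]

/-- Swapping the blocks of a block diagonal matrix. -/
theorem sim_fromBlocks_swap (A : Matrix m m ℂ) (B : Matrix n n ℂ) :
    Sim (Matrix.fromBlocks A 0 0 B) (Matrix.fromBlocks B 0 0 A) := by
  have h := sim_submatrix (Equiv.sumComm m n) (Matrix.fromBlocks B 0 0 A)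
  rwa [Equiv.sumComm_apply, Matrix.fromBlocks_submatrix_sum_swap_sum_swap] at h

set_option synthInstance.maxSize 4096 in
/-- Interleaving the blocks of `(A ⊕ A ⊕ B) ⊕ (A' ⊕ A' ⊕ B')`. -/
theorem sim_fromBlocks_interleave (A A' : Matrix m m ℂ) (B B' : Matrix n n ℂ) :
    Sim (Matrix.fromBlocks (Matrix.fromBlocks (Matrix.fromBlocks A 0 0 A) 0 0 B) 0 0
        (Matrix.fromBlocks (Matrix.fromBlocks A' 0 0 A') 0 0 B'))
      (Matrix.fromBlocks (Matrix.fromBlocks (Matrix.fromBlocks (Matrix.fromBlocks A 0 0 A') 0 0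
        (Matrix.fromBlocks A 0 0 A')) 0 0 B) 0 0 B') := by
  let e : ((m ⊕ m) ⊕ n) ⊕ ((m ⊕ m) ⊕ n) ≃ (((m ⊕ m) ⊕ (m ⊕ m)) ⊕ n) ⊕ n :=
    { toFun
        | .inl (.inl (.inl i)) => .inl (.inl (.inl (.inl i)))
        | .inl (.inl (.inr i)) => .inl (.inl (.inr (.inl i)))
        | .inl (.inr i) => .inl (.inr i)
        | .inr (.inl (.inl i)) => .inl (.inl (.inl (.inr i)))
        | .inr (.inl (.inr i)) => .inl (.inl (.inr (.inr i)))
        | .inr (.inr i) => .inr i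
      invFun
        | .inl (.inl (.inl (.inl i))) => .inl (.inl (.inl i))
        | .inl (.inl (.inr (.inl i))) => .inl (.inl (.inr i))
        | .inl (.inr i) => .inl (.inr i)
        | .inl (.inl (.inl (.inr i))) => .inr (.inl (.inl i))
        | .inl (.inl (.inr (.inr i))) => .inr (.inl (.inr i))
        | .inr i => .inr (.inr i)
      left_inv := by rintro (((i | i) | i) | ((i | i) | i)) <;> rfl
      right_inv := by rintro ((((i | i) | (i | i)) | i) | i) <;> rfl }
  convert sim_submatrix e _ using 1
  ext (((i | i) | i) | ((i | i) | i)) (((j | j) | j) | ((j | j) | j)) <;> rfl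

theorem sim_diagonal (e : m ≃ n) {d : m → ℂ} {d' : n → ℂ} (h : ∀ i, d i = d' (e i)) :
    Sim (diagonal d) (diagonal d') := by
  convert sim_submatrix e (diagonal d') using 1
  rw [Matrix.submatrix_diagonal_equiv]
  exact congrArg diagonal (funext h)

theorem Sim.kronecker_self {A : Matrix m m ℂ} {B : Matrix n n ℂ} (h : Sim A B) :
    Sim (A ⊗ₖ A) (B ⊗ₖ B) := by
  obtain ⟨P, Q, hPQ, hQP, rfl⟩ := h
  exact ⟨P ⊗ₖ P, Q ⊗ₖ Q, by rw [← Matrix.mul_kronecker_mul, hPQ, Matrix.one_kronecker_one],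
    by rw [← Matrix.mul_kronecker_mul, hQP, Matrix.one_kronecker_one],
    by rw [Matrix.mul_kronecker_mul, Matrix.mul_kronecker_mul]⟩

/-- A Hermitian matrix is similar to a diagonal matrix with the same index type. -/
theorem IsHermitian.exists_sim_diagonal {A : Matrix m m ℂ} (hA : A.IsHermitian) :
    ∃ d : m → ℂ, Sim A (diagonal d) := by
  refine ⟨RCLike.ofReal ∘ hA.eigenvalues, hA.eigenvectorUnitary,
    star (hA.eigenvectorUnitary : Matrix m m ℂ), by simp, by simp, ?_⟩
  simpa [Unitary.conjStarAlgAut_apply] using hA.spectral_theorem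

/-! ### The second compound and the Kronecker square -/

/-- The increasing pairs of indices. -/
abbrev IncPair (m : Type) [LinearOrder m] : Type := {p : m × m // p.1 < p.2}

section Compound

variable {k : Type} [LinearOrder k]

/-- The second compound of a matrix: its two by two minors. -/
def compoundTwo (A : Matrix k k ℂ) : Matrix (IncPair k) (IncPair k) ℂ :=
  Matrix.of fun p q => A p.1.1 q.1.1 * A p.1.2 q.1.2 - A p.1.1 q.1.2 * A p.1.2 q.1.1

/-- A pair of indices is an increasing pair, the swap of one, or on the diagonal. -/
def prodEquivIncPair : k × k ≃ (IncPair k ⊕ IncPair k) ⊕ k where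
  toFun p := if h : p.1 < p.2 then .inl (.inl ⟨p, h⟩)
    else if h' : p.2 < p.1 then .inl (.inr ⟨p.swap, h'⟩) else .inr p.1
  invFun
    | .inl (.inl p) => p.1
    | .inl (.inr p) => p.1.swap
    | .inr i => (i, i)
  left_inv p := by
    by_cases h : p.1 < p.2
    · simp [h]
    · by_cases h' : p.2 < p.1
      · simp [h, h']
      · simpa [h, h', Prod.ext_iff] using le_antisymm (not_lt.1 h') (not_lt.1 h)
  right_inv := by
    rintro ((⟨p, hp⟩ | ⟨p, hp⟩) | i)
    · simp [hp]
    · simp [hp, hp.not_gt]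
    · simp

/-- Cauchy–Binet for two by two minors: the `B`-minor is antisymmetric in the summation pair, so
diagonal pairs cancel and each pair merges with its swap into a minor of `A`. -/
theorem compoundTwo_mul [Fintype k] (A B : Matrix k k ℂ) :
    compoundTwo (A * B) = compoundTwo A * compoundTwo B := by
  ext p q
  have key : ∀ r s u v : k, (A * B) r u * (A * B) s v - (A * B) r v * (A * B) s u =
      ∑ x : k × k, A r x.1 * A s x.2 * (B x.1 u * B x.2 v - B x.1 v * B x.2 u) := by
    intro r s u v
    simp only [Matrix.mul_apply, Finset.sum_mul_sum, ← Fintype.sum_prod_type',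
      ← Finset.sum_sub_distrib]
    exact Finset.sum_congr rfl fun x _ => by ring
  simp only [compoundTwo, Matrix.of_apply, Matrix.mul_apply (M := Matrix.of _)]
  rw [key, ← prodEquivIncPair.symm.sum_comp, Fintype.sum_sum_type, Fintype.sum_sum_type,
    ← Finset.sum_add_distrib]
  have hdiag : ∑ i : k, A p.1.1 (prodEquivIncPair.symm (.inr i)).1 *
      A p.1.2 (prodEquivIncPair.symm (.inr i)).2 *
      (B (prodEquivIncPair.symm (.inr i)).1 q.1.1 * B (prodEquivIncPair.symm (.inr i)).2 q.1.2 -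
      B (prodEquivIncPair.symm (.inr i)).1 q.1.2 * B (prodEquivIncPair.symm (.inr i)).2 q.1.1)
      = 0 := by
    refine Finset.sum_eq_zero fun i _ => ?_
    simp only [prodEquivIncPair, Equiv.coe_fn_symm_mk]
    ring
  rw [hdiag, add_zero]
  refine Finset.sum_congr rfl fun x _ => ?_
  simp only [prodEquivIncPair, Equiv.coe_fn_symm_mk, Prod.fst_swap, Prod.snd_swap]
  ring

theorem compoundTwo_diagonal (d : k → ℂ) :
    compoundTwo (diagonal d) = diagonal fun p => d p.1.1 * d p.1.2 := by
  ext ⟨⟨a, b⟩, h⟩ ⟨⟨a', b'⟩, h'⟩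
  simp only [compoundTwo, Matrix.of_apply, Matrix.diagonal_apply, Subtype.mk.injEq,
    Prod.mk.injEq]
  grind

theorem compoundTwo_one : compoundTwo (1 : Matrix k k ℂ) = 1 := by
  rw [← Matrix.diagonal_one, compoundTwo_diagonal]
  simp

theorem Sim.compoundTwo [Fintype k] {A B : Matrix k k ℂ} (h : Sim A B) :
    Sim (compoundTwo A) (compoundTwo B) := by
  obtain ⟨P, Q, hPQ, hQP, rfl⟩ := h
  exact ⟨Matrix.compoundTwo P, Matrix.compoundTwo Q,
    by rw [← compoundTwo_mul, hPQ, compoundTwo_one],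
    by rw [← compoundTwo_mul, hQP, compoundTwo_one], by simp only [compoundTwo_mul]⟩

set_option synthInstance.maxSize 1024 in
/-- For a Hermitian matrix, the Kronecker square splits into two copies of the second compound
and the square of the matrix. -/
theorem IsHermitian.sim_kronecker_self [Fintype k] {A : Matrix k k ℂ} (hA : A.IsHermitian) :
    Sim (A ⊗ₖ A) (Matrix.fromBlocks
      (Matrix.fromBlocks (Matrix.compoundTwo A) 0 0 (Matrix.compoundTwo A)) 0 0 (A * A)) := by
  obtain ⟨d, hd⟩ := hA.exists_sim_diagonal
  refine hd.kronecker_self.trans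
    (Sim.trans ?_ ((hd.compoundTwo.fromBlocks hd.compoundTwo).fromBlocks hd.pow_two).symm)
  rw [compoundTwo_diagonal, Matrix.diagonal_mul_diagonal, Matrix.fromBlocks_diagonal,
    Matrix.fromBlocks_diagonal, Matrix.diagonal_kronecker_diagonal]
  refine (sim_diagonal prodEquivIncPair.symm ?_).symm
  rintro ((p | p) | i)
  · rfl
  · exact mul_comm _ _
  · rfl

end Compound

end Matrix

open Matrix

/-! ### From matrix similarity to graph similarity -/

namespace WeightedDigraph

theorem adjMatrix_disjUnion {V W : Type} (G : WeightedDigraph V) (H : WeightedDigraph W) :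
    (G.disjUnion H).adjMatrix = Matrix.fromBlocks G.adjMatrix 0 0 H.adjMatrix := by
  ext (u | u) (v | v) <;> simp [adjMatrix, disjUnion] <;> rfl

theorem adjMatrix_ofSimpleGraph_apply {V : Type} (G : SimpleGraph V) (u v : V) {p : Prop}
    [Decidable p] (h : G.Adj u v ↔ p) :
    (ofSimpleGraph G).adjMatrix u v = if p then 1 else 0 := by
  simp only [adjMatrix, ofSimpleGraph, Matrix.of_apply, h]

theorem adjMatrix_ofSimpleGraph_eq_zero {V : Type} (G : SimpleGraph V) (u v : V)
    (h : ¬ G.Adj u v) : (ofSimpleGraph G).adjMatrix u v = 0 :=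
  if_neg h

theorem similar_of_sim {V W : Type} [Fintype V] [DecidableEq V] [Fintype W] [DecidableEq W]
    {G : WeightedDigraph V} {H : WeightedDigraph W} (h : Sim G.adjMatrix H.adjMatrix) :
    G.Similar H := by
  obtain ⟨P, Q, hPQ, hQP, hG⟩ := h
  -- Invertibility forces equal cardinalities; any bijection will do, since `P` and `Q` absorb the
  -- relabelling.
  let e : V ≃ W := Fintype.equivOfCardEq (Matrix.square_of_invertible P Q hPQ hQP)
  refine ⟨e, ⟨P.submatrix e.symm id, Q.submatrix id e.symm, ?_, ?_⟩, ?_⟩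
  · rw [Matrix.submatrix_mul _ _ e.symm id e.symm Function.bijective_id |>.symm, hPQ,
      Matrix.submatrix_one_equiv]
  · rw [Matrix.submatrix_mul _ _ id e.symm id e.symm.bijective |>.symm, hQP,
      Matrix.submatrix_id_id]
  · rw [hG]
    ext i j
    simp [Matrix.mul_apply]

end WeightedDigraph

open WeightedDigraph

/-! ### The path matrix and its square -/

/-- The adjacency between the even and the odd vertices of the path on `2 * n` vertices, the even
ones being listed backwards. -/
noncomputable def pathBiadjacency (n : ℕ) : Matrix (Fin n) (Fin n) ℂ :=
  Matrix.of fun a b => if (a : ℕ) + b + 1 = n ∨ (a : ℕ) + b + 2 = n then 1 else 0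

theorem pathBiadjacency_isHermitian (n : ℕ) : (pathBiadjacency n).IsHermitian := by
  ext a b
  simp [pathBiadjacency, add_comm (a : ℕ) b]

/-- By symmetry the square counts two-step walks between even vertices of the path. Loop weights are
degrees: the last index is the path's end vertex `0`, of degree one. -/
theorem pathBiadjacency_mul_self (n : ℕ) :
    pathBiadjacency n * pathBiadjacency n = (loopedPathR n).adjMatrix := by
  ext a c
  have hsplit : ∀ b : Fin n, pathBiadjacency n a b * pathBiadjacency n b c =
      (if b = a.rev then pathBiadjacency n b c else 0) +
      (if (a : ℕ) + b + 2 = n then pathBiadjacency n b c else 0) := by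
    intro b
    simp only [pathBiadjacency, Matrix.of_apply, Fin.ext_iff, Fin.val_rev]
    grind
  rw [Matrix.mul_apply, Finset.sum_congr rfl fun b _ => hsplit b, Finset.sum_add_distrib,
    Finset.sum_ite_eq' Finset.univ a.rev]
  by_cases ha : (a : ℕ) + 1 = n
  · rw [Finset.sum_eq_zero fun b _ => if_neg (by omega)]
    simp only [pathBiadjacency, Matrix.of_apply, Fin.val_rev, adjMatrix, loopedPathR, loopedPath,
      SimpleGraph.pathGraph_adj, Fin.ext_iff, Finset.mem_univ, if_true]
    grind
  · have hb : ∀ b : Fin n, ((a : ℕ) + b + 2 = n) = (b = ⟨n - 2 - a, by omega⟩) := by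
      intro b
      simp only [Fin.ext_iff, eq_iff_iff]
      omega
    simp only [hb]
    rw [Finset.sum_ite_eq' Finset.univ]
    simp only [pathBiadjacency, Matrix.of_apply, Fin.val_rev, adjMatrix, loopedPathR, loopedPath,
      SimpleGraph.pathGraph_adj, Fin.ext_iff, Finset.mem_univ, if_true]
    grind

/-- Conjugation by alternating signs negates the edges of the path and fixes its loops. -/
theorem loopedPathR'_sim (n : ℕ) :
    Sim (loopedPathR' n).adjMatrix (-(loopedPathR n).adjMatrix) := by
  let s : Fin n → ℂ := fun i => (-1) ^ (i : ℕ)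
  have hs : Matrix.diagonal s * Matrix.diagonal s = 1 := by
    rw [Matrix.diagonal_mul_diagonal, ← Matrix.diagonal_one]
    congr 1
    ext i
    simp [s, ← mul_pow]
  refine ⟨Matrix.diagonal s, Matrix.diagonal s, hs, hs, ?_⟩
  ext i j
  have hi : s i * s i = 1 := by simp [s, ← mul_pow]
  simp only [Matrix.mul_diagonal, Matrix.diagonal_mul, Matrix.neg_apply, adjMatrix, loopedPathR,
    loopedPathR', loopedPath, SimpleGraph.pathGraph_adj, Matrix.of_apply]
  by_cases hij : i = j
  · subst hij
    by_cases hl : (i : ℕ) + 1 = n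
    · simp only [hl, or_true, if_true]
      linear_combination hi
    · simp only [hl, or_true, if_true, if_false]
      linear_combination 2 * hi
  · by_cases h : (i : ℕ) + 1 = j ∨ (j : ℕ) + 1 = i
    · have hsij : s i * s j = -1 := by
        rcases h with h | h
        · simp only [s, ← h, pow_succ]
          linear_combination -hi
        · have hj : s j * s j = 1 := by simp [s, ← mul_pow]
          simp only [s, ← h, pow_succ]
          linear_combination -hj
      simp only [h, hij, true_or, if_true, if_false]
      linear_combination hsij
    · simp [h, hij]

/-! ### The mixed Aztec diamond -/

/-- The black squares of the board, split by the parity of their coordinates. -/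
def blackSquareMap (n : ℕ) : (Fin n × Fin n) ⊕ (Fin n × Fin n) → BlackSquare n
  | .inl p => ⟨(⟨2 * n - 2 - 2 * p.1, by omega⟩, ⟨2 * n - 2 - 2 * p.2, by omega⟩),
      by simp only; rw [Nat.even_iff]; omega⟩
  | .inr p => ⟨(⟨2 * p.1 + 1, by omega⟩, ⟨2 * p.2 + 1, by omega⟩),
      by simp only; rw [Nat.even_iff]; omega⟩

theorem blackSquareMap_bijective (n : ℕ) : Function.Bijective (blackSquareMap n) := by
  constructor
  · rintro (⟨a, b⟩ | ⟨a, b⟩) (⟨c, d⟩ | ⟨c, d⟩) h <;>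
      simp only [blackSquareMap, Subtype.mk.injEq, Prod.mk.injEq, Fin.mk.injEq] at h <;>
      simp only [Sum.inl.injEq, Sum.inr.injEq, Prod.mk.injEq, Fin.ext_iff, reduceCtorEq] <;>
      omega
  · rintro ⟨⟨i, j⟩, h⟩
    simp only at h
    rw [Nat.even_iff] at h
    rcases Nat.mod_two_eq_zero_or_one i with hi | hi
    · refine ⟨.inl (⟨n - 1 - i / 2, by omega⟩, ⟨n - 1 - j / 2, by omega⟩), ?_⟩
      simp only [blackSquareMap, Subtype.mk.injEq, Prod.mk.injEq, Fin.ext_iff]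
      omega
    · refine ⟨.inr (⟨i / 2, by omega⟩, ⟨j / 2, by omega⟩), ?_⟩
      simp only [blackSquareMap, Subtype.mk.injEq, Prod.mk.injEq, Fin.ext_iff]
      omega

theorem mixedDiamond_sim (n : ℕ) :
    Sim (ofSimpleGraph (mixedDiamond n)).adjMatrix
      (Matrix.fromBlocks (pathBiadjacency n ⊗ₖ pathBiadjacency n) 0 0
        (-(pathBiadjacency n ⊗ₖ pathBiadjacency n))) := by
  refine Sim.trans (Sim.symm ?_) (sim_fromBlocks_antidiagonal _)
  convert sim_submatrix (Equiv.ofBijective _ (blackSquareMap_bijective n)) _ using 1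
  ext (⟨a, b⟩ | ⟨a, b⟩) (⟨c, d⟩ | ⟨c, d⟩) <;>
    simp only [Matrix.fromBlocks_apply₁₁, Matrix.fromBlocks_apply₁₂, Matrix.fromBlocks_apply₂₁,
      Matrix.fromBlocks_apply₂₂, Matrix.zero_apply, Matrix.kroneckerMap_apply, pathBiadjacency,
      Matrix.of_apply, Matrix.submatrix_apply, Equiv.ofBijective_apply, blackSquareMap,
      ite_zero_mul_ite_zero, one_mul]
  · refine (adjMatrix_ofSimpleGraph_eq_zero _ _ _ fun h => ?_).symm
    simp only [mixedDiamond] at h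
    omega
  · refine (adjMatrix_ofSimpleGraph_apply _ _ _ ?_).symm
    simp only [mixedDiamond]
    omega
  · refine (adjMatrix_ofSimpleGraph_apply _ _ _ ?_).symm
    simp only [mixedDiamond]
    omega
  · refine (adjMatrix_ofSimpleGraph_eq_zero _ _ _ fun h => ?_).symm
    simp only [mixedDiamond] at h
    omega

/-! ### The halved mixed Aztec diamond -/

/-- The black squares on or above the diagonal of the board of side `2 * m`, split by the parity
of their coordinates: these are the squares strictly above the diagonal of the board of side
`2 * (m + 1)`, moved down by two rows. -/
def upperBlackSquareMap (m : ℕ) :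
    IncPair (Fin (m + 1)) ⊕ IncPair (Fin (m + 1)) → UpperBlackSquare m
  -- Counting backwards reverses order, so the larger index gives the column. This swap matches the
  -- surviving cross product in the minors of `A`.
  | .inl p => have h := Fin.lt_def.1 p.2
      ⟨⟨(⟨2 * m - 2 * p.1.2, by omega⟩, ⟨2 * m - 2 - 2 * p.1.1, by omega⟩),
      by simp only; rw [Nat.even_iff]; omega⟩, by simp only [Fin.mk_le_mk]; omega⟩
  | .inr p => have h := Fin.lt_def.1 p.2
      ⟨⟨(⟨2 * p.1.1 + 1, by omega⟩, ⟨2 * p.1.2 - 1, by omega⟩),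
      by simp only; rw [Nat.even_iff]; omega⟩, by simp only [Fin.mk_le_mk]; omega⟩

theorem upperBlackSquareMap_bijective (m : ℕ) : Function.Bijective (upperBlackSquareMap m) := by
  constructor
  · rintro (⟨⟨a, b⟩, hab⟩ | ⟨⟨a, b⟩, hab⟩) (⟨⟨c, d⟩, hcd⟩ | ⟨⟨c, d⟩, hcd⟩) h <;>
      simp only [upperBlackSquareMap, Subtype.mk.injEq, Prod.mk.injEq, Fin.mk.injEq] at h <;>
      simp only [Sum.inl.injEq, Sum.inr.injEq, Subtype.mk.injEq, Prod.mk.injEq, Fin.ext_iff,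
        reduceCtorEq, Fin.lt_def] at hab hcd ⊢ <;>
      omega
  · rintro ⟨⟨⟨i, j⟩, h⟩, hij⟩
    simp only [Fin.le_def] at h hij
    rw [Nat.even_iff] at h
    rcases Nat.mod_two_eq_zero_or_one i with hi | hi
    · refine ⟨.inl ⟨(⟨m - 1 - j / 2, by omega⟩, ⟨m - i / 2, by omega⟩), ?_⟩, ?_⟩
      · simp only [Fin.mk_lt_mk]
        omega
      · simp only [upperBlackSquareMap, Subtype.mk.injEq, Prod.mk.injEq, Fin.ext_iff]
        omega
    · refine ⟨.inr ⟨(⟨i / 2, by omega⟩, ⟨j / 2 + 1, by omega⟩), ?_⟩, ?_⟩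
      · simp only [Fin.mk_lt_mk]
        omega
      · simp only [upperBlackSquareMap, Subtype.mk.injEq, Prod.mk.injEq, Fin.ext_iff]
        omega

/-- Nonzero entries have index sum `n - 1` or `n - 2`, but `a < b` and `c < d` give `b + d ≥ a + c +
2`. -/
theorem compoundTwo_pathBiadjacency_apply (n : ℕ) (p q : IncPair (Fin n)) :
    compoundTwo (pathBiadjacency n) p q =
      -(pathBiadjacency n p.1.1 q.1.2 * pathBiadjacency n p.1.2 q.1.1) := by
  obtain ⟨⟨a, b⟩, hab⟩ := p
  obtain ⟨⟨c, d⟩, hcd⟩ := q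
  simp only [Fin.lt_def] at hab hcd
  have h : pathBiadjacency n a c * pathBiadjacency n b d = 0 := by
    simp only [pathBiadjacency, Matrix.of_apply, ite_zero_mul_ite_zero, one_mul]
    exact if_neg (by omega)
  simp only [compoundTwo, Matrix.of_apply, h, zero_sub]

theorem halvedMixedDiamond_sim (m : ℕ) :
    Sim (ofSimpleGraph (halvedMixedDiamond m)).adjMatrix
      (Matrix.fromBlocks (compoundTwo (pathBiadjacency (m + 1))) 0 0
        (-compoundTwo (pathBiadjacency (m + 1)))) := by
  refine Sim.trans (Sim.symm ?_) ((sim_fromBlocks_antidiagonal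
    (-compoundTwo (pathBiadjacency (m + 1)))).trans ?_)
  · convert sim_submatrix (Equiv.ofBijective _ (upperBlackSquareMap_bijective m)) _ using 1
    ext (⟨⟨a, b⟩, hab⟩ | ⟨⟨a, b⟩, hab⟩) (⟨⟨c, d⟩, hcd⟩ | ⟨⟨c, d⟩, hcd⟩) <;>
      simp only [Fin.lt_def] at hab hcd <;>
      simp only [Matrix.fromBlocks_apply₁₁, Matrix.fromBlocks_apply₁₂, Matrix.fromBlocks_apply₂₁,
        Matrix.fromBlocks_apply₂₂, Matrix.zero_apply, Matrix.neg_apply,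
        compoundTwo_pathBiadjacency_apply, neg_neg, Matrix.submatrix_apply,
        Equiv.ofBijective_apply, upperBlackSquareMap]
    · refine (adjMatrix_ofSimpleGraph_eq_zero _ _ _ fun h => ?_).symm
      simp only [halvedMixedDiamond, SimpleGraph.comap_adj, mixedDiamond] at h
      omega
    · simp only [pathBiadjacency, Matrix.of_apply, ite_zero_mul_ite_zero, one_mul]
      refine (adjMatrix_ofSimpleGraph_apply _ _ _ ?_).symm
      simp only [halvedMixedDiamond, SimpleGraph.comap_adj, mixedDiamond]
      omega
    · simp only [pathBiadjacency, Matrix.of_apply, ite_zero_mul_ite_zero, one_mul]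
      refine (adjMatrix_ofSimpleGraph_apply _ _ _ ?_).symm
      simp only [halvedMixedDiamond, SimpleGraph.comap_adj, mixedDiamond]
      omega
    · refine (adjMatrix_ofSimpleGraph_eq_zero _ _ _ fun h => ?_).symm
      simp only [halvedMixedDiamond, SimpleGraph.comap_adj, mixedDiamond] at h
      omega
  · rw [neg_neg]
    exact sim_fromBlocks_swap _ _

theorem theorem3p1 (n : ℕ) (hn : 1 ≤ n) :
    WeightedDigraph.Similar
      (WeightedDigraph.ofSimpleGraph (mixedDiamond n))
      ((((WeightedDigraph.ofSimpleGraph (halvedMixedDiamond (n - 1))).disjUnion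
          (WeightedDigraph.ofSimpleGraph (halvedMixedDiamond (n - 1)))).disjUnion
        (loopedPathR n)).disjUnion
          (loopedPathR' n)) := by
  obtain ⟨m, rfl⟩ := Nat.exists_eq_add_of_le' hn
  apply similar_of_sim
  have hA := (pathBiadjacency_isHermitian (m + 1)).sim_kronecker_self
  have hH := halvedMixedDiamond_sim m
  rw [pathBiadjacency_mul_self] at hA
  simp only [adjMatrix_disjUnion]
  -- Both `A ⊗ A` and its negative are split; pairing each `C` with a `-C` then yields the two
  -- halved diamonds.
  refine (mixedDiamond_sim (m + 1)).trans (((hA.fromBlocks hA.neg).trans ?_).trans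
    (((hH.fromBlocks hH).fromBlocks (Sim.refl _)).fromBlocks (loopedPathR'_sim _)).symm)
  simpa only [Matrix.fromBlocks_neg, neg_zero] using sim_fromBlocks_interleave
    (compoundTwo (pathBiadjacency (m + 1))) (-compoundTwo (pathBiadjacency (m + 1)))
    (loopedPathR (m + 1)).adjMatrix (-(loopedPathR (m + 1)).adjMatrix)
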